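/- Let $n\ge 2$. Let $X_n^+=\{0,\dots,n-1\}^{\mathbb N}$ be the one-sided full shift, with points $x=x_1x_2\dots$ and metric $d(x,y)=2^{-\min\{j\ge 1:\,x_j\ne y_j\}}$ for $x\neq y$. For $k\ge 1$ let $\mathrm{Sym}(n^k)$ be the group of all permutations of the $n^k$ words of length $k$ over $\{0,\dots,n-1\}$. It acts on $X_n^+$ by prefix permutation, $\tau(x)=\tau(x_1\dots x_k)\,x_{k+1}x_{k+2}\dots$. Let $\mathcal S_n=\bigcup_k \mathrm{Sym}(n^k)\subset \mathrm{Homeo}(X_n^+)$, a locally finite group. The group $\mathcal S_n$ also acts (not continuously) on $\mathbb T=\mathbb R/\mathbb Z$, with its usual metric, by base-$n$ prefix permutation: for a word $w=w_1\dots w_k$ put $e(w)=\sum_{j=1}^k w_j n^{-j}$ and $I_w=[e(w),e(w)+n^{-k})\subset\mathbb T$; then $\tau\in\mathrm{Sym}(n^k)$ maps $I_w$ onto $I_{\tau(w)}$ by translation, for every word $w$ of length $k$. For $X=\mathbb T$ or $X=X_n^+$, a set $Y\subset X$ and $\varepsilon>0$, put $$\mathcal Z_k(Y,\varepsilon)=\frac{1}{|\mathrm{Sym}(n^k)|}\,\bigl|\{g\in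 \mathrm{Sym}(n^k): d_H(g(Y),X)<\varepsilon\}\bigr|,$$ where $d_H$ is the Hausdorff distance, so that $d_H(g(Y),X)=\sup_{x\in X}\inf_{y\in Y}d(x,g(y))$ for nonempty $Y$. **Theorem.** 1. If $Y\subset\mathbb T$ is an infinite set, then for every $\varepsilon>0$ we have $\mathcal Z_k(Y,\varepsilon)\to 1$ as $k\to\infty$. 2. If $Y\subset X_n^+$ is an infinite set, then for every $\varepsilon>0$ we have $\mathcal Z_k(Y,\varepsilon)\to 1$ as $k\to\infty$. -/

import Mathlib

open Set Filter Topology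

noncomputable section

/-- Words of length `k` over the alphabet `{0, …, n - 1}`; there are `n ^ k` of them. -/
abbrev Word (n k : ℕ) : Type := Fin k → Fin n

/-- The one-sided full shift `X_n⁺` on `n` symbols. The letter that is usually written `x_{i+1}`
(`i ≥ 0`) is `x i`. -/
def OneSidedShift (n : ℕ) : Type := ℕ → Fin n

namespace OneSidedShift

/-- The product topology of the discrete topologies. -/
instance (n : ℕ) : TopologicalSpace (OneSidedShift n) :=
  inferInstanceAs (TopologicalSpace (ℕ → Fin n))

open scoped Classical in
/-- `d(x, y) = 2 ^ (-j)`, where `j ≥ 1` is the position of the first letter at which `x` and `y`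
differ (positions are counted from `1`), and `d(x, x) = 0`. -/
def shiftDist {n : ℕ} (x y : OneSidedShift n) : ℝ :=
  if x = y then 0 else (1 / 2 : ℝ) ^ (PiNat.firstDiff (E := fun _ => Fin n) x y + 1)

theorem shiftDist_eq {n : ℕ} (x y : OneSidedShift n) :
    shiftDist x y = (1 / 2) * (PiNat.dist (E := fun _ => Fin n)).dist x y := by
  unfold shiftDist
  by_cases h : x = y
  · subst h
    rw [if_pos rfl, PiNat.dist_self (E := fun _ => Fin n) x, mul_zero]
  · rw [if_neg h, PiNat.dist_eq_of_ne (E := fun _ => Fin n) h, pow_succ, mul_comm]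

/-- The metric `shiftDist`; its topology is the product topology. -/
instance (n : ℕ) : MetricSpace (OneSidedShift n) :=
  MetricSpace.ofDistTopology shiftDist
    (fun x => by simp [shiftDist])
    (fun x y => by
      rw [shiftDist_eq, shiftDist_eq, PiNat.dist_comm (E := fun _ => Fin n) x y])
    (fun x y z => by
      have := PiNat.dist_triangle (E := fun _ => Fin n) x y z
      rw [shiftDist_eq, shiftDist_eq, shiftDist_eq]
      linarith)
    (fun s => by
      refine (PiNat.isOpen_iff_dist (E := fun _ => Fin n) s).trans
        (forall₂_congr fun x _ => ⟨?_, ?_⟩)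
      · rintro ⟨ε, hε, h⟩
        refine ⟨ε / 2, by positivity, fun y hy => h y ?_⟩
        have := (shiftDist_eq (n := n) x y).symm.trans_lt hy
        linarith
      · rintro ⟨ε, hε, h⟩
        refine ⟨ε * 2, by positivity, fun y hy => h y ?_⟩
        refine (shiftDist_eq (n := n) x y).trans_lt ?_
        linarith)
    (fun x y h => by
      by_contra hne
      rw [shiftDist, if_neg hne] at h
      exact absurd h (by positivity))

end OneSidedShift

/-- `τ(x₁ … x_k) x_{k+1} x_{k+2} …`: replace the length-`k` prefix of `x` by its image
under `τ`. -/
def applyPrefix {n k : ℕ} (τ : Equiv.Perm (Word n k)) (x : OneSidedShift n) : OneSidedShift n :=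
  fun i => if h : i < k then τ (fun j => x j) ⟨i, h⟩ else x i

theorem applyPrefix_one {n k : ℕ} (x : OneSidedShift n) :
    applyPrefix (1 : Equiv.Perm (Word n k)) x = x := by
  funext i
  simp [applyPrefix]

theorem applyPrefix_mul {n k : ℕ} (σ τ : Equiv.Perm (Word n k)) (x : OneSidedShift n) :
    applyPrefix (σ * τ) x = applyPrefix σ (applyPrefix τ x) := by
  funext i
  by_cases h : i < k
  · simp [applyPrefix, h]
  · simp [applyPrefix, h]

theorem continuous_applyPrefix {n k : ℕ} (τ : Equiv.Perm (Word n k)) :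
    Continuous (applyPrefix τ) := by
  refine continuous_pi (A := fun _ => Fin n) fun i => ?_
  by_cases h : i < k
  · have h1 : Continuous fun x : OneSidedShift n => (fun j : Fin k => x j) :=
      continuous_pi fun j => continuous_apply (A := fun _ => Fin n) (j : ℕ)
    have h2 : Continuous fun w : Word n k => τ w ⟨i, h⟩ := continuous_of_discreteTopology
    have h3 : (fun x : OneSidedShift n => applyPrefix τ x i) =
        (fun w : Word n k => τ w ⟨i, h⟩) ∘ fun x j => x j := by
      funext x
      simp [applyPrefix, h]
    rw [h3]
    exact h2.comp h1
  · have h3 : (fun x : OneSidedShift n => applyPrefix τ x i) = fun x => x i := by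
      funext x
      simp [applyPrefix, h]
    rw [h3]
    exact continuous_apply (A := fun _ => Fin n) i

/-- The action of `Sym(n^k)`, the group of all permutations of the `n ^ k` words of length `k`,
on `X_n⁺` by prefix permutation, as a homomorphism to the homeomorphism group. -/
def prefixHom (n k : ℕ) :
    Equiv.Perm (Word n k) →* (OneSidedShift n ≃ₜ OneSidedShift n) where
  toFun τ :=
    { toFun := applyPrefix τ
      invFun := applyPrefix τ⁻¹
      left_inv := fun x => by rw [← applyPrefix_mul, inv_mul_cancel, applyPrefix_one]
      right_inv := fun x => by rw [← applyPrefix_mul, mul_inv_cancel, applyPrefix_one]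
      continuous_toFun := continuous_applyPrefix τ
      continuous_invFun := continuous_applyPrefix τ⁻¹ }
  map_one' := by ext x; exact applyPrefix_one x
  map_mul' σ τ := by ext x; exact applyPrefix_mul σ τ x

/-- The locally finite group `𝒮_n = ⋃_k Sym(n^k)`, inside the homeomorphism group of `X_n⁺`. -/
def prefixGroup (n : ℕ) : Subgroup (OneSidedShift n ≃ₜ OneSidedShift n) :=
  ⨆ k : ℕ, (prefixHom n k).range

theorem prefixHom_range_mono (n : ℕ) : Monotone fun k => (prefixHom n k).range := by
  classical
  refine monotone_nat_of_le_succ fun k => ?_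
  rintro _ ⟨τ, rfl⟩
  let ext (σ : Equiv.Perm (Word n k)) (w : Word n (k + 1)) : Word n (k + 1) :=
    fun i => if h : (i : ℕ) < k then σ (fun j => w j.castSucc) ⟨i, h⟩ else w i
  have key : ∀ σ ρ : Equiv.Perm (Word n k), σ * ρ = 1 → ∀ w, ext σ (ext ρ w) = w := by
    intro σ ρ h w
    have h' : ∀ u, σ (ρ u) = u := fun u => by rw [← Equiv.Perm.mul_apply, h]; rfl
    funext i
    by_cases hi : (i : ℕ) < k
    · simp [ext, hi, h']
    · simp [ext, hi]
  refine ⟨⟨ext τ, ext τ⁻¹, key _ _ (inv_mul_cancel τ), key _ _ (mul_inv_cancel τ)⟩, ?_⟩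
  ext x
  change applyPrefix _ x = applyPrefix τ x
  funext i
  by_cases h1 : i < k
  · have h2 : i < k + 1 := by omega
    simp [applyPrefix, h1, h2, ext]
  · by_cases h2 : i < k + 1
    · simp [applyPrefix, h1, h2, ext]
    · simp [applyPrefix, h1, h2]

/-- The group is the union of the groups `Sym(n^k)`. -/
theorem mem_prefixGroup_iff {n : ℕ} {g : OneSidedShift n ≃ₜ OneSidedShift n} :
    g ∈ prefixGroup n ↔ ∃ k, ∃ τ : Equiv.Perm (Word n k), prefixHom n k τ = g := by
  rw [prefixGroup, Subgroup.mem_iSup_of_directed (prefixHom_range_mono n).directed_le]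
  rfl

/-- The element of `𝒮_n` given by a permutation of the words of length `k`. -/
def ofPerm {n k : ℕ} (τ : Equiv.Perm (Word n k)) : prefixGroup n :=
  ⟨prefixHom n k τ, mem_prefixGroup_iff.2 ⟨k, τ, rfl⟩⟩

/-- `F_k = Sym(n^k)`, as a subset of `𝒮_n`. -/
def symSet (n k : ℕ) : Set (prefixGroup n) := Set.range (ofPerm (n := n) (k := k))

/-- The action of `𝒮_n` on `X_n⁺`. -/
instance (n : ℕ) : MulAction (prefixGroup n) (OneSidedShift n) where
  smul g x := (g : OneSidedShift n ≃ₜ OneSidedShift n) x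
  one_smul _ := rfl
  mul_smul _ _ _ := rfl

theorem shift_smul_def {n : ℕ} (g : prefixGroup n) (x : OneSidedShift n) :
    g • x = (g : OneSidedShift n ≃ₜ OneSidedShift n) x := rfl

theorem ofPerm_smul_shift {n k : ℕ} (τ : Equiv.Perm (Word n k)) (x : OneSidedShift n) :
    ofPerm τ • x = applyPrefix τ x := rfl

theorem exists_tail_eq {n : ℕ} (g : prefixGroup n) :
    ∃ N, ∀ (x : OneSidedShift n) (i : ℕ), N ≤ i → (g • x) i = x i := by
  obtain ⟨k, τ, h⟩ := mem_prefixGroup_iff.1 g.2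
  refine ⟨k, fun x i hi => ?_⟩
  rw [shift_smul_def, ← h]
  change applyPrefix τ x i = x i
  simp [applyPrefix, hi]

/-! ### The circle -/

/-- The base-`n` coding map `π_n : X_n⁺ → 𝕋 = ℝ/ℤ`, `x ↦ ∑_{j ≥ 1} x_j / n ^ j`. -/
def codingMap {n : ℕ} (x : OneSidedShift n) : UnitAddCircle :=
  ((∑' i : ℕ, ((x i : ℕ) : ℝ) / (n : ℝ) ^ (i + 1) : ℝ) : UnitAddCircle)

/-- The base-`n` expansion `ξ : 𝕋 → X_n⁺` of the representative in `[0, 1)`; of the two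
expansions of an `n`-adic rational it is the one that ends in zeros. -/
def expansion (n : ℕ) [NeZero n] (t : UnitAddCircle) : OneSidedShift n :=
  Real.digits (AddCircle.equivIco 1 0 t : ℝ) n

theorem codingMap_eq {n : ℕ} (x : OneSidedShift n) :
    codingMap x = (Real.ofDigits (b := n) x : UnitAddCircle) := by
  simp [codingMap, Real.ofDigits, Real.ofDigitsTerm, div_eq_mul_inv]

theorem equivIco_mem (t : UnitAddCircle) :
    (AddCircle.equivIco (1 : ℝ) 0 t : ℝ) ∈ Set.Ico (0 : ℝ) 1 := by
  simpa using (AddCircle.equivIco (1 : ℝ) 0 t).2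

theorem codingMap_expansion (n : ℕ) [n.AtLeastTwo] (t : UnitAddCircle) :
    codingMap (expansion n t) = t := by
  have hn : 1 < n := Nat.AtLeastTwo.one_lt
  rw [codingMap_eq, expansion, Real.ofDigits_digits hn (equivIco_mem t)]
  exact AddCircle.coe_equivIco

/-- The sequence does not end in the constant digit `n - 1`. -/
def IsProper {n : ℕ} (x : OneSidedShift n) : Prop :=
  ∀ N, ∃ i, N ≤ i ∧ (x i : ℕ) ≠ n - 1

theorem ofDigits_lt_one {n : ℕ} [n.AtLeastTwo] {x : OneSidedShift n} (hx : IsProper x) :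
    Real.ofDigits (b := n) x < 1 := by
  have hn : 1 < n := Nat.AtLeastTwo.one_lt
  obtain ⟨i, -, hi⟩ := hx 0
  rw [← Real.ofDigits_const_last_eq_one' hn]
  refine Summable.tsum_lt_tsum (i := i) (fun j => ?_) ?_ Real.summable_ofDigitsTerm
    Real.summable_ofDigitsTerm
  · have h2 : (x j : ℕ) ≤ n - 1 := by have := (x j).isLt; omega
    simp only [Real.ofDigitsTerm]
    gcongr
  · have h2 : (x i : ℕ) < n - 1 := by have := (x i).isLt; omega
    simp only [Real.ofDigitsTerm]
    gcongr

theorem IsProper.tail {n : ℕ} {x : OneSidedShift n} (hx : IsProper x) (N : ℕ) :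
    IsProper (n := n) fun i => x (i + N) := by
  intro M
  obtain ⟨i, hi, h⟩ := hx (M + N)
  exact ⟨i - N, by omega, by
    change (x (i - N + N) : ℕ) ≠ n - 1
    rwa [Nat.sub_add_cancel (by omega)]⟩

theorem isProper_digits {n : ℕ} [n.AtLeastTwo] {y : ℝ} (hy : y ∈ Set.Ico (0 : ℝ) 1) :
    IsProper (n := n) (Real.digits y n) := by
  have hn : 1 < n := Nat.AtLeastTwo.one_lt
  intro N
  by_contra! H
  have h1 := Real.ofDigits_eq_sum_add_ofDigits (b := n) (Real.digits y n) N
  have h2 : (fun i => Real.digits y n (i + N)) =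
      fun _ => (⟨n - 1, Nat.sub_one_lt_of_lt hn⟩ : Fin n) := by
    funext i
    exact Fin.ext (H (i + N) (by omega))
  rw [h2, Real.ofDigits_const_last_eq_one' hn, Real.ofDigits_digits hn hy, mul_one] at h1
  have h3 := Real.ofDigits_digits_sum_eq (b := n) hy N
  have h4 := Nat.lt_floor_add_one ((n : ℝ) ^ N * y)
  have h5 : (n : ℝ) ^ N ≠ 0 := by positivity
  rw [← h3] at h4
  have h6 : (n : ℝ) ^ N * y =
      n ^ N * ∑ i ∈ Finset.range N, Real.ofDigitsTerm (Real.digits y n) i + 1 := by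
    conv_lhs => rw [h1]
    rw [mul_add, mul_inv_cancel₀ h5]
  linarith

theorem digits_ofDigits {n : ℕ} [n.AtLeastTwo] {x : OneSidedShift n} (hx : IsProper x) :
    Real.digits (Real.ofDigits (b := n) x) n = x := by
  have hn : 1 < n := Nat.AtLeastTwo.one_lt
  have hn0 : (n : ℝ) ≠ 0 := by positivity
  have key : ∀ m, ∃ q : ℕ, (n : ℝ) ^ m * ∑ j ∈ Finset.range m, Real.ofDigitsTerm (b := n) x j
      = q := by
    intro m
    induction m with
    | zero => exact ⟨0, by simp⟩
    | succ m ih =>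
      obtain ⟨q, hq⟩ := ih
      refine ⟨n * q + x m, ?_⟩
      rw [Finset.sum_range_succ, mul_add, pow_succ', mul_assoc, hq, ← pow_succ',
        show Real.ofDigitsTerm (b := n) x m = (x m : ℕ) * ((n : ℝ) ^ (m + 1))⁻¹ from rfl,
        mul_left_comm, mul_inv_cancel₀ (by positivity)]
      push_cast
      ring
  funext i
  obtain ⟨q, hq⟩ := key i
  have h1 := Real.ofDigits_eq_sum_add_ofDigits (b := n) x (i + 1)
  have h2 := ofDigits_lt_one (hx.tail (i + 1))
  have h3 := Real.ofDigits_nonneg (b := n) fun j => x (j + (i + 1))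
  have h4 : Real.ofDigits (b := n) x * (n : ℝ) ^ (i + 1) =
      ((n * q + x i : ℕ) : ℝ) + Real.ofDigits (b := n) fun j => x (j + (i + 1)) := by
    rw [h1, Finset.sum_range_succ, add_mul, add_mul, mul_right_comm,
      inv_mul_cancel₀ (by positivity),
      show Real.ofDigitsTerm (b := n) x i = (x i : ℕ) * ((n : ℝ) ^ (i + 1))⁻¹ from rfl, mul_assoc ((x i : ℕ) : ℝ), inv_mul_cancel₀ (by positivity), pow_succ',
      mul_comm, mul_assoc, hq]
    push_cast
    ring
  have h5 : ⌊Real.ofDigits (b := n) x * (n : ℝ) ^ (i + 1)⌋₊ = n * q + x i := by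
    rw [h4, Nat.floor_eq_iff (by positivity)]
    exact ⟨by linarith, by linarith⟩
  apply Fin.ext
  simp only [Real.digits, h5, Fin.val_ofNat]
  rw [Nat.mul_add_mod, Nat.mod_eq_of_lt (x i).isLt]

theorem isProper_expansion {n : ℕ} [n.AtLeastTwo] (t : UnitAddCircle) :
    IsProper (expansion n t) := isProper_digits (equivIco_mem t)

theorem expansion_codingMap {n : ℕ} [n.AtLeastTwo] {x : OneSidedShift n} (hx : IsProper x) :
    expansion n (codingMap x) = x := by
  have h : Real.ofDigits (b := n) x ∈ Set.Ico (0 : ℝ) (0 + 1) :=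
    ⟨Real.ofDigits_nonneg _, by simpa using ofDigits_lt_one hx⟩
  rw [codingMap_eq, expansion, AddCircle.equivIco_coe_of_mem h, digits_ofDigits hx]

theorem IsProper.smul {n : ℕ} {x : OneSidedShift n} (hx : IsProper x) (g : prefixGroup n) :
    IsProper (g • x) := by
  obtain ⟨K, hK⟩ := exists_tail_eq g
  intro N
  obtain ⟨i, hi, h⟩ := hx (max N K)
  exact ⟨i, (le_max_left _ _).trans hi, by rwa [hK x i ((le_max_right _ _).trans hi)]⟩

/-- The action of `𝒮_n` on `𝕋` by prefix permutation of numbers in base `n`: permute the prefix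
of the base-`n` expansion. By `ofPerm_smul_circle` below, `τ ∈ Sym(n^k)` translates the
interval `I_w` onto `I_{τ(w)}` for every word `w` of length `k`. -/
instance (n : ℕ) [n.AtLeastTwo] : MulAction (prefixGroup n) UnitAddCircle where
  smul g t := codingMap (g • expansion n t)
  one_smul t := by
    change codingMap ((1 : prefixGroup n) • expansion n t) = t
    rw [one_smul, codingMap_expansion]
  mul_smul g h t := by
    change codingMap ((g * h) • expansion n t) =
      codingMap (g • expansion n (codingMap (h • expansion n t)))
    rw [expansion_codingMap ((isProper_expansion t).smul h), mul_smul]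

theorem circle_smul_def {n : ℕ} [n.AtLeastTwo] (g : prefixGroup n) (t : UnitAddCircle) :
    g • t = codingMap (g • expansion n t) := rfl

/-- The number `e(w) = ∑_{j = 1}^{k} w_j / n ^ j`, the left end point of
`I_w = [e(w), e(w) + n ^ (-k))`. -/
def leftEnd {n k : ℕ} (w : Word n k) : ℝ := ∑ j : Fin k, ((w j : ℕ) : ℝ) / (n : ℝ) ^ ((j : ℕ) + 1)

/-- A permutation `τ` of the words of length `k` maps `I_w` to `I_{τ(w)}` by translation. -/
theorem ofPerm_smul_circle {n k : ℕ} [n.AtLeastTwo] (τ : Equiv.Perm (Word n k)) (w : Word n k)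
    {y : ℝ} (hy : y ∈ Set.Ico (leftEnd w) (leftEnd w + 1 / (n : ℝ) ^ k)) :
    ofPerm τ • (y : UnitAddCircle) = ((leftEnd (τ w) + (y - leftEnd w) : ℝ) : UnitAddCircle) := by
  have hn : 1 < n := Nat.AtLeastTwo.one_lt
  have hpos : (0 : ℝ) < (n : ℝ) ^ k := by positivity
  have hz : (y - leftEnd w) * (n : ℝ) ^ k ∈ Set.Ico (0 : ℝ) 1 := by
    refine ⟨mul_nonneg (by linarith [hy.1]) hpos.le, ?_⟩
    rw [← lt_div_iff₀ hpos]
    linarith [hy.2]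
  let d : OneSidedShift n := Real.digits ((y - leftEnd w) * (n : ℝ) ^ k) n
  let s (u : Word n k) : OneSidedShift n := fun i => if h : i < k then u ⟨i, h⟩ else d (i - k)
  have hs : ∀ u, Real.ofDigits (b := n) (s u) = leftEnd u + (y - leftEnd w) := by
    intro u
    have ht : (fun i => s u (i + k)) = d := by
      funext i
      simp [s]
    have hd : Real.ofDigits (b := n) d = (y - leftEnd w) * (n : ℝ) ^ k :=
      Real.ofDigits_digits hn hz
    rw [Real.ofDigits_eq_sum_add_ofDigits (b := n) (s u) k, ht, hd, leftEnd,
      Finset.sum_range]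
    congr 1
    · refine Finset.sum_congr rfl fun j _ => ?_
      simp [Real.ofDigitsTerm, s, div_eq_mul_inv]
    · field_simp
  have hp : IsProper (s w) := by
    intro N
    obtain ⟨i, hi, h⟩ := isProper_digits (n := n) hz N
    refine ⟨i + k, by omega, ?_⟩
    simpa [s, d] using h
  have hyw : (y : UnitAddCircle) = codingMap (s w) := by
    rw [codingMap_eq, hs]
    congr 1
    ring
  have hτ : ofPerm τ • s w = s (τ w) := by
    rw [ofPerm_smul_shift]
    funext i
    by_cases h : i < k
    · simp [applyPrefix, s, h]
    · simp [applyPrefix, s, h]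
  rw [circle_smul_def, hyw, expansion_codingMap hp, hτ, codingMap_eq, hs]

/-! ### Proportions -/

/-- `𝒵_k(Y, ε) = |{g ∈ F_k : d_H(g(Y), X) < ε}| / |F_k|`, for a group `G` acting on a metric
space `X`, a sequence `F` of finite subsets of `G` and `Y ⊆ X`; here `d_H` is the Hausdorff
distance. -/
def hitProportion {G X : Type*} [Group G] [MetricSpace X] [MulAction G X] (F : ℕ → Set G)
    (k : ℕ) (Y : Set X) (ε : ℝ) : ℝ :=
  ({g ∈ F k | Metric.hausdorffDist ((fun x => g • x) '' Y) Set.univ < ε}.ncard : ℝ) /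
    ((F k).ncard : ℝ)

end

/-! Fix a number a of points of Y whose codings in the shift are distinct. Once k is large they have
a distinct prefixes of length k, and a uniformly random permutation τ of the words of length k sends
these prefixes to a random injective sample. A sample without replacement avoids a set at least as
often as an independent one lands in its complement: τ maps a given words into C with probability at
most (|C| / n^k)^a. With C the words that do not begin with u, where u has length m ≤ k, this is at
most (1 - n^(-m))^a. The union bound over the n^m words u shows that τ(Y) meets every cylinder of
length m with probability at least 1 - n^m (1 - n^(-m))^a. This is close to 1 for large a and does
not depend on k.

Cylinders of length m have small diameter in the shift, and so do their images under the coding map,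
so meeting all of them forces small Hausdorff distance. On the circle the expansion need not be
continuous: it only has to be injective, so that an infinite set stays infinite, and a right inverse
of the coding map. -/

/-! ### Counting permutations that map one finite set into another -/

open Finset in
/-- Adding one point to the set `A` of constrained points. -/
theorem card_perm_mapsTo_insert_mul_le {α : Type*} [Fintype α] [DecidableEq α] (A C : Finset α)
    {x : α} (hx : x ∉ A) :
    #{τ : Equiv.Perm α | ∀ y ∈ insert x A, τ y ∈ C} * (Fintype.card α - #A) ≤
      #{τ : Equiv.Perm α | ∀ y ∈ A, τ y ∈ C} * (#C - #A) := by
  have hfib : ∀ σ ∈ ({τ : Equiv.Perm α | ∀ y ∈ A, τ y ∈ C} : Finset (Equiv.Perm α)),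
      #(C.map σ⁻¹.toEmbedding \ A) ≤ #C - #A := by
    intro σ hσ
    have hA : A ⊆ C.map σ⁻¹.toEmbedding := fun y hy =>
      mem_map.2 ⟨σ y, (mem_filter.1 hσ).2 y hy, by simp⟩
    rw [card_sdiff_of_subset hA, card_map]
  calc _ = #(({τ : Equiv.Perm α | ∀ y ∈ insert x A, τ y ∈ C} : Finset _) ×ˢ Aᶜ) := by
        rw [card_product, card_compl]
    _ ≤ #(({τ : Equiv.Perm α | ∀ y ∈ A, τ y ∈ C} : Finset (Equiv.Perm α)).sigma
          fun σ => C.map σ⁻¹.toEmbedding \ A) := by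
        -- For y outside A, σ = τ ∘ (x y) agrees with τ on A and satisfies σ y = τ x ∈ C. So y is
        -- one of the |C| - |A| points of σ⁻¹(C) outside A, and τ is recovered from σ and y.
        refine card_le_card_of_injOn (fun p => ⟨p.1 * Equiv.swap x p.2, p.2⟩) ?_ ?_
        · rintro ⟨τ, y⟩ h
          simp only [coe_product, Set.mem_prod, mem_coe, mem_filter, Finset.mem_univ, true_and,
            Finset.mem_compl] at h
          simp only [coe_sigma, Set.mem_sigma_iff, mem_coe, mem_filter, Finset.mem_univ, true_and,
            Finset.mem_sdiff]
          refine ⟨fun z hz => ?_, mem_map.2 ⟨τ x, h.1 x (mem_insert_self _ _), ?_⟩, h.2⟩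
          · rw [Equiv.Perm.mul_apply, Equiv.swap_apply_of_ne_of_ne]
            · exact h.1 z (mem_insert_of_mem hz)
            · rintro rfl; exact hx hz
            · rintro rfl; exact h.2 hz
          · simp
        · rintro ⟨τ, y⟩ - ⟨σ, z⟩ - h
          simp only [Sigma.mk.injEq, heq_eq_eq] at h
          obtain ⟨h1, rfl⟩ := h
          rw [mul_right_cancel h1]
    _ ≤ _ := by
        rw [card_sigma]
        exact sum_le_card_nsmul _ _ _ hfib

open Finset in
/-- The proportion of the permutations that map `A` into `C` is at most `(|C| / |α|) ^ |A|`. -/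
theorem card_perm_mapsTo_mul_le {α : Type*} [Fintype α] [DecidableEq α] (A C : Finset α) :
    #{τ : Equiv.Perm α | ∀ y ∈ A, τ y ∈ C} * Fintype.card α ^ #A ≤
      #C ^ #A * Fintype.card (Equiv.Perm α) := by
  induction A using Finset.induction_on with
  | empty => simp
  | insert x A hx ih =>
    have hA : 0 < Fintype.card α - #A := by
      have := card_lt_univ_of_notMem hx
      omega
    -- Sampling without replacement: (|C| - |A|) / (|α| - |A|) ≤ |C| / |α|, because |C| ≤ |α|.
    have hle : (#C - #A) * Fintype.card α ≤ #C * (Fintype.card α - #A) := by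
      rw [Nat.sub_mul, Nat.mul_sub]
      have := Nat.mul_le_mul_left #A (card_le_univ C)
      rw [mul_comm #C #A]
      omega
    have hstep : #{τ : Equiv.Perm α | ∀ y ∈ insert x A, τ y ∈ C} * Fintype.card α ≤
        #{τ : Equiv.Perm α | ∀ y ∈ A, τ y ∈ C} * #C := by
      refine Nat.le_of_mul_le_mul_right ?_ hA
      calc _ = #{τ : Equiv.Perm α | ∀ y ∈ insert x A, τ y ∈ C} * (Fintype.card α - #A) *
            Fintype.card α := by ring
        _ ≤ #{τ : Equiv.Perm α | ∀ y ∈ A, τ y ∈ C} * (#C - #A) * Fintype.card α :=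
            Nat.mul_le_mul_right _ (card_perm_mapsTo_insert_mul_le A C hx)
        _ ≤ #{τ : Equiv.Perm α | ∀ y ∈ A, τ y ∈ C} * (#C * (Fintype.card α - #A)) := by
            rw [mul_assoc]
            exact Nat.mul_le_mul_left _ hle
        _ = _ := by ring
    rw [card_insert_of_notMem hx]
    calc _ = #{τ : Equiv.Perm α | ∀ y ∈ insert x A, τ y ∈ C} * Fintype.card α *
          Fintype.card α ^ #A := by ring
      _ ≤ #{τ : Equiv.Perm α | ∀ y ∈ A, τ y ∈ C} * #C * Fintype.card α ^ #A :=
          Nat.mul_le_mul_right _ hstep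
      _ = #{τ : Equiv.Perm α | ∀ y ∈ A, τ y ∈ C} * Fintype.card α ^ #A * #C := by ring
      _ ≤ #C ^ #A * Fintype.card (Equiv.Perm α) * #C := Nat.mul_le_mul_right _ ih
      _ = _ := by ring

/-! ### Permutations of words that miss a cylinder -/

-- Appending the n^l words of length l to u gives n^l words that are excluded, out of n^(m + l).
open Finset in
theorem card_words_prefix_ne_div_le {n : ℕ} [n.AtLeastTwo] (m l : ℕ) (u : Word n m) :
    (#{w : Word n (m + l) | (fun i => w (Fin.castAdd l i)) ≠ u} : ℝ) /
      Fintype.card (Word n (m + l)) ≤ 1 - 1 / (n : ℝ) ^ m := by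
  have hn : (0 : ℝ) < n := by
    exact_mod_cast Nat.zero_lt_of_lt (Nat.AtLeastTwo.one_lt (n := n))
  have h1 : n ^ l ≤ #{w : Word n (m + l) | (fun i => w (Fin.castAdd l i)) = u} := by
    calc n ^ l = #(univ : Finset (Word n l)) := by simp [Word]
      _ ≤ _ := card_le_card_of_injOn (fun v => Fin.append u v)
        (fun v _ => by simp) (fun v _ v' _ h => by
          funext i
          simpa using congrFun h (Fin.natAdd m i))
  have h2 := card_filter_add_card_filter_not (s := (univ : Finset (Word n (m + l))))
    (fun w => (fun i => w (Fin.castAdd l i)) = u)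
  have h3 : #(univ : Finset (Word n (m + l))) = n ^ (m + l) := by simp [Word]
  have h4 : Fintype.card (Word n (m + l)) = n ^ (m + l) := h3
  rw [h3] at h2
  rw [h4, Nat.cast_pow, div_le_iff₀ (by positivity)]
  have h5 : (n : ℝ) ^ l + #{w : Word n (m + l) | (fun i => w (Fin.castAdd l i)) ≠ u} ≤
      n ^ (m + l) := by
    exact_mod_cast h2 ▸ Nat.add_le_add_right h1 _
  rw [sub_mul, pow_add, one_mul, one_div, inv_mul_cancel_left₀ (by positivity), ← pow_add]
  linarith

open Finset in
/-- The proportion of the permutations of the words of length `m + l` that map no word in `A` to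
a word with a certain prefix of length `m`. -/
theorem card_perm_prefix_missing_le {n : ℕ} [n.AtLeastTwo] {m l : ℕ} (A : Finset (Word n (m + l))) :
    (#{τ : Equiv.Perm (Word n (m + l)) |
      ∃ u : Word n m, ∀ w ∈ A, (fun i => τ w (Fin.castAdd l i)) ≠ u} : ℝ) ≤
      n ^ m * (1 - 1 / (n : ℝ) ^ m) ^ #A * Fintype.card (Equiv.Perm (Word n (m + l))) := by
  have hn : 0 < n := Nat.zero_lt_of_lt (Nat.AtLeastTwo.one_lt (n := n))
  have hu : ∀ u : Word n m, (#{τ : Equiv.Perm (Word n (m + l)) |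
      ∀ w ∈ A, (fun i => τ w (Fin.castAdd l i)) ≠ u} : ℝ) ≤
      (1 - 1 / (n : ℝ) ^ m) ^ #A * Fintype.card (Equiv.Perm (Word n (m + l))) := by
    intro u
    have h := card_perm_mapsTo_mul_le A
      ({w : Word n (m + l) | (fun i => w (Fin.castAdd l i)) ≠ u} : Finset _)
    simp only [mem_filter, Finset.mem_univ, true_and] at h
    have hpos : (0 : ℝ) < Fintype.card (Word n (m + l)) := by
      simp only [Word, Fintype.card_pi, Fintype.card_fin, prod_const, card_univ]
      positivity
    have h' : (#{τ : Equiv.Perm (Word n (m + l)) |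
        ∀ w ∈ A, (fun i => τ w (Fin.castAdd l i)) ≠ u} : ℝ) ≤
        ((#{w : Word n (m + l) | (fun i => w (Fin.castAdd l i)) ≠ u} : ℝ) /
          Fintype.card (Word n (m + l))) ^ #A * Fintype.card (Equiv.Perm (Word n (m + l))) := by
      rw [div_pow, div_mul_eq_mul_div, le_div_iff₀ (by positivity)]
      exact_mod_cast h
    refine h'.trans ?_
    gcongr
    exact card_words_prefix_ne_div_le m l u
  -- Union bound over the n^m possible missing prefixes, which produces the factor n^m.
  have hsub : ({τ : Equiv.Perm (Word n (m + l)) |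
      ∃ u : Word n m, ∀ w ∈ A, (fun i => τ w (Fin.castAdd l i)) ≠ u} : Finset _) ⊆
      univ.biUnion fun u : Word n m => {τ : Equiv.Perm (Word n (m + l)) |
        ∀ w ∈ A, (fun i => τ w (Fin.castAdd l i)) ≠ u} := by
    intro τ
    simp
  calc _ ≤ ((∑ u : Word n m, #{τ : Equiv.Perm (Word n (m + l)) |
        ∀ w ∈ A, (fun i => τ w (Fin.castAdd l i)) ≠ u} : ℕ) : ℝ) := by
        exact_mod_cast (Finset.card_le_card hsub).trans card_biUnion_le
    _ ≤ ∑ _u : Word n m,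
        (1 - 1 / (n : ℝ) ^ m) ^ #A * Fintype.card (Equiv.Perm (Word n (m + l))) := by
        push_cast
        exact sum_le_sum fun u _ => hu u
    _ = _ := by
        simp [Word, mul_assoc]

/-! ### From counting permutations to the limit of proportions -/

theorem ofPerm_injective (n k : ℕ) [n.AtLeastTwo] :
    Function.Injective (ofPerm (n := n) (k := k)) := by
  have hn : 0 < n := Nat.zero_lt_of_lt (Nat.AtLeastTwo.one_lt (n := n))
  intro σ τ h
  refine Equiv.ext fun w => funext fun i => ?_
  let x : OneSidedShift n := fun i => if h : i < k then w ⟨i, h⟩ else ⟨0, hn⟩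
  have hx : (fun j : Fin k => x j) = w := by
    funext j
    simp [x]
  have h1 : applyPrefix σ x = applyPrefix τ x := by
    rw [← ofPerm_smul_shift, ← ofPerm_smul_shift, h]
  have h2 := congrFun h1 i
  simpa only [applyPrefix, Fin.is_lt, dif_pos, Fin.eta, hx] using h2

/-- Finitely many points of the shift have distinct prefixes of all large enough lengths. -/
theorem eventually_injOn_prefix {n : ℕ} {F : Set (OneSidedShift n)} (hF : F.Finite) :
    ∀ᶠ k in atTop, Set.InjOn (fun (x : OneSidedShift n) (i : Fin k) => x i) F := by
  have h : ∀ x ∈ F, ∀ y ∈ F, ∀ᶠ k in atTop,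
      (fun i : Fin k => x i) = (fun i : Fin k => y i) → x = y := by
    intro x _ y _
    by_cases hxy : x = y
    · exact Eventually.of_forall fun _ _ => hxy
    · obtain ⟨i, hi⟩ := Function.ne_iff.1 hxy
      filter_upwards [eventually_gt_atTop i] with k hk h
      exact absurd (congrFun h ⟨i, hk⟩) hi
  have h' : ∀ᶠ k in atTop, ∀ x ∈ F, ∀ y ∈ F,
      (fun i : Fin k => x i) = (fun i : Fin k => y i) → x = y :=
    (eventually_all_finite hF).2 fun x hx => (eventually_all_finite hF).2 fun y hy => h x hx y hy
  filter_upwards [h'] with k hk x hx y hy using hk x hx y hy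

/-- Injectivity of `ofPerm` turns a count of group elements into a count of permutations, to which
the bounds above apply. -/
theorem hitProportion_symSet_eq {n : ℕ} [n.AtLeastTwo] {X : Type*} [MetricSpace X]
    [MulAction (prefixGroup n) X] (k : ℕ) (Y : Set X) (ε : ℝ) :
    hitProportion (symSet n) k Y ε =
      ({τ : Equiv.Perm (Word n k) |
        Metric.hausdorffDist ((fun x => ofPerm τ • x) '' Y) Set.univ < ε}.ncard : ℝ) /
        Fintype.card (Equiv.Perm (Word n k)) := by
  have h1 : {g ∈ symSet n k | Metric.hausdorffDist ((fun x => g • x) '' Y) Set.univ < ε} =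
      ofPerm '' {τ : Equiv.Perm (Word n k) |
        Metric.hausdorffDist ((fun x => ofPerm τ • x) '' Y) Set.univ < ε} := by
    ext g
    constructor
    · rintro ⟨⟨τ, rfl⟩, h⟩
      exact ⟨τ, h, rfl⟩
    · rintro ⟨τ, h, rfl⟩
      exact ⟨⟨τ, rfl⟩, h⟩
  rw [hitProportion, h1, Set.ncard_image_of_injective _ (ofPerm_injective n k), symSet,
    ← Set.image_univ, Set.ncard_image_of_injective _ (ofPerm_injective n k), Set.ncard_univ,
    Nat.card_eq_fintype_card]

open Finset in
/-- If `ξ` codes the points of `X` in the shift, and a translate of `Y` is `ε`-dense as soon as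
the corresponding translate of `ξ(Y)` meets all cylinders of length `m`, then most translates of an
infinite coded set are `ε`-dense. -/
theorem tendsto_hitProportion_of_cylinders {n : ℕ} [n.AtLeastTwo] {X : Type*} [MetricSpace X]
    [MulAction (prefixGroup n) X] (ξ : X → OneSidedShift n) {Y : Set X} (hY : (ξ '' Y).Infinite)
    {ε : ℝ} (m : ℕ)
    (hm : ∀ g : prefixGroup n, (∀ u : Word n m, ∃ y ∈ Y, ∀ i : Fin m, (g • ξ y) i = u i) →
      Metric.hausdorffDist ((fun x => g • x) '' Y) Set.univ < ε) :
    Tendsto (fun k => hitProportion (symSet n) k Y ε) atTop (𝓝 1) := by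
  classical
  have hn : 0 < n := Nat.zero_lt_of_lt (Nat.AtLeastTwo.one_lt (n := n))
  refine tendsto_order.2 ⟨fun r hr => ?_, fun r hr => Eventually.of_forall fun k => ?_⟩
  · have hnm : (1 : ℝ) ≤ (n : ℝ) ^ m := one_le_pow₀ (by exact_mod_cast hn)
    have hlim : Tendsto (fun a => 1 - (n : ℝ) ^ m * (1 - 1 / (n : ℝ) ^ m) ^ a) atTop (𝓝 1) := by
      have h := (tendsto_pow_atTop_nhds_zero_of_lt_one (r := 1 - 1 / (n : ℝ) ^ m)
        (by rw [sub_nonneg]; exact (div_le_one (by positivity)).2 hnm)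
        (by rw [sub_lt_self_iff]; positivity)).const_mul ((n : ℝ) ^ m)
      simpa using h.const_sub 1
    -- The number a of sample points is chosen before k, from r and m alone; the resulting lower
    -- bound holds for all large k.
    obtain ⟨a, ha⟩ := ((tendsto_order.1 hlim).1 r hr).exists
    obtain ⟨F, hF, hFa⟩ := hY.exists_subset_card_eq a
    filter_upwards [eventually_injOn_prefix F.finite_toSet, eventually_ge_atTop m] with k hk hmk
    obtain ⟨l, rfl⟩ := Nat.exists_eq_add_of_le hmk
    refine ha.trans_le ?_
    set A : Finset (Word n (m + l)) := F.image fun x i => x i with hA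
    have hAcard : #A = a := by rw [hA, card_image_of_injOn hk, hFa]
    have hmiss := card_perm_prefix_missing_le A
    rw [hAcard] at hmiss
    have hsplit := card_filter_add_card_filter_not
      (s := (univ : Finset (Equiv.Perm (Word n (m + l)))))
      (fun τ => ∃ u : Word n m, ∀ w ∈ A, (fun i => τ w (Fin.castAdd l i)) ≠ u)
    rw [card_univ] at hsplit
    have hsub : #{τ : Equiv.Perm (Word n (m + l)) |
        ¬ ∃ u : Word n m, ∀ w ∈ A, (fun i => τ w (Fin.castAdd l i)) ≠ u} ≤
        {τ : Equiv.Perm (Word n (m + l)) |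
          Metric.hausdorffDist ((fun x => ofPerm τ • x) '' Y) Set.univ < ε}.ncard := by
      rw [← Set.ncard_coe_finset]
      refine Set.ncard_le_ncard (fun τ hτ => hm _ fun u => ?_) (Set.toFinite _)
      simp only [coe_filter, Finset.mem_univ, true_and, Set.mem_ofPred_eq, not_exists, not_forall,
        not_not] at hτ
      obtain ⟨w, hw, rfl⟩ := hτ u
      obtain ⟨x, hx, rfl⟩ := Finset.mem_image.1 hw
      obtain ⟨y, hy, rfl⟩ := hF hx
      -- Since m ≤ k, the first m letters of the translate are read off from τ applied to the prefix
      -- of length k.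
      refine ⟨y, hy, fun i => ?_⟩
      have hi : (i : ℕ) < m + l := by omega
      rw [ofPerm_smul_shift, applyPrefix, dif_pos hi]
      rfl
    have hpos : (0 : ℝ) < Fintype.card (Equiv.Perm (Word n (m + l))) := by
      exact_mod_cast Fintype.card_pos
    rw [hitProportion_symSet_eq, le_div_iff₀ hpos, sub_mul, one_mul]
    have h1 : (Fintype.card (Equiv.Perm (Word n (m + l))) : ℝ) ≤
        #{τ : Equiv.Perm (Word n (m + l)) |
          ∃ u : Word n m, ∀ w ∈ A, (fun i => τ w (Fin.castAdd l i)) ≠ u} +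
        {τ : Equiv.Perm (Word n (m + l)) |
          Metric.hausdorffDist ((fun x => ofPerm τ • x) '' Y) Set.univ < ε}.ncard := by
      exact_mod_cast hsplit.symm.trans_le (Nat.add_le_add_left hsub _)
    linarith
  · refine lt_of_le_of_lt ?_ hr
    rw [hitProportion_symSet_eq]
    refine div_le_one_of_le₀ ?_ (by positivity)
    rw [← Nat.card_eq_fintype_card]
    exact_mod_cast Set.ncard_le_card _

/-! ### Diameters of cylinders, and the theorem -/

theorem dist_le_of_forall_lt_eq {n m : ℕ} {x y : OneSidedShift n} (h : ∀ i < m, x i = y i) :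
    dist x y ≤ (1 / 2 : ℝ) ^ m := by
  change OneSidedShift.shiftDist x y ≤ _
  unfold OneSidedShift.shiftDist
  split_ifs with hxy
  · positivity
  -- As positions count from 1, the distance is even at most 2^(-(m + 1)); the weaker bound
  -- suffices.
  · refine pow_le_pow_of_le_one (by norm_num) (by norm_num) ?_
    by_contra! hlt
    exact PiNat.apply_firstDiff_ne (E := fun _ => Fin n) hxy (h _ (by omega))

theorem dist_codingMap_le {n m : ℕ} [n.AtLeastTwo] {x y : OneSidedShift n}
    (h : ∀ i < m, x i = y i) : dist (codingMap x) (codingMap y) ≤ (1 / n : ℝ) ^ m := by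
  rw [codingMap_eq, codingMap_eq, dist_eq_norm, ← AddCircle.coe_sub, one_div, inv_pow]
  exact QuotientAddGroup.norm_mk_le_norm.trans (Real.abs_ofDigits_sub_ofDigits_le h)

theorem mainTheorem9 (n : ℕ) [n.AtLeastTwo] :
    (∀ Y : Set UnitAddCircle, Y.Infinite → ∀ ε : ℝ, 0 < ε →
      Tendsto (fun k => hitProportion (symSet n) k Y ε) atTop (𝓝 1)) ∧
    (∀ Y : Set (OneSidedShift n), Y.Infinite → ∀ ε : ℝ, 0 < ε →
      Tendsto (fun k => hitProportion (symSet n) k Y ε) atTop (𝓝 1)) := by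
  have hn : 1 < n := Nat.AtLeastTwo.one_lt
  constructor
  · intro Y hY ε hε
    have hn' : (1 / n : ℝ) < 1 := by
      rw [div_lt_one (by positivity)]
      exact_mod_cast hn
    obtain ⟨m, hm⟩ := exists_pow_lt_of_lt_one hε hn'
    have hinj : Function.Injective (expansion n) :=
      Function.LeftInverse.injective (codingMap_expansion n)
    refine tendsto_hitProportion_of_cylinders (expansion n) (hY.image hinj.injOn) m
      fun g hg => lt_of_le_of_lt ?_ hm
    refine Metric.hausdorffDist_le_of_mem_dist (by positivity)
      (fun x _ => ⟨x, Set.mem_univ x, by rw [dist_self]; positivity⟩) fun t _ => ?_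
    -- The cylinder to hit is the one containing the expansion of t.
    obtain ⟨y, hy, h⟩ := hg fun i => expansion n t i
    refine ⟨g • y, ⟨y, hy, rfl⟩, ?_⟩
    have hd := dist_codingMap_le (x := expansion n t) fun i hi => (h ⟨i, hi⟩).symm
    rwa [codingMap_expansion] at hd
  · intro Y hY ε hε
    obtain ⟨m, hm⟩ := exists_pow_lt_of_lt_one hε (show (1 / 2 : ℝ) < 1 by norm_num)
    refine tendsto_hitProportion_of_cylinders id (by rwa [Set.image_id]) m
      fun g hg => lt_of_le_of_lt ?_ hm
    refine Metric.hausdorffDist_le_of_mem_dist (by positivity)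
      (fun x _ => ⟨x, Set.mem_univ x, by rw [dist_self]; positivity⟩) fun x _ => ?_
    obtain ⟨y, hy, h⟩ := hg fun i => x i
    exact ⟨g • y, ⟨y, hy, rfl⟩, dist_le_of_forall_lt_eq fun i hi => (h ⟨i, hi⟩).symm⟩
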